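/- Status updates are generated every $1/\lambda_0$ seconds. Update $n$ has system delay $D_n=T_n+D_n^{[0]}+D_n^{[i]}$: a transmission time $T_n=\Phi_n/S_n$ (packet volume $\Phi_n\ge 0$ over semantic rate $S_n>0$) with finite mean $\mathbb E[\Phi_n/S_n]$ not depending on $n$; the delay $D_n^{[0]}$ in a scheduler; and the delay $D_n^{[i]}$ in server $i$, where $i=1$ if the update is of Category I (semantic similarity $\xi_n\ge\hat\xi$) and $i=2$ if it is of Category II ($\xi_n<\hat\xi$). A delay in a component is waiting time plus service time. The scheduler is a first-come-first-served D/M/1 queue in steady state with inter-arrival time $1/\lambda_0$ and service rate $\mu_0$, $0<\lambda_0<\mu_0$. Server $i$ is modelled as a first-come-first-served G/M/1 queue in steady state with i.i.d. inter-arrival times of an arbitrary law $G_i$ on $[0,\infty)$ of mean $1/\lambda_i$ and with service rate $\mu_i$, $0<\lambda_i<\mu_i$. Categories I and II occur with probabilities $a$ and $b$, $a+b=1$, and the category of an update is independent of its delay in server $1$ and of its delay in server $2$. For system delays $D_n$ and inter-generation times $G_n=1/\lambda_0$, the average age of information (AoI) is $\mathbb E[Q_n]/\mathbb E[G_n]$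 with $Q_n=\frac12(G_n+D_n)^2-\frac12D_n^2$. Let $\overline\Delta^{[i]}$ be the average AoI of updates served by server $i$ (system delay $T_n+D^{[0]}_n+D^{[i]}_n$), and $\overline\Delta$ the average AoI over all updates, each one being served according to its category. Put $\rho_0=\lambda_0/\mu_0$, let $\mathcal W$ be the principal branch of the Lambert $W$ function, and let $\eta_i$ be the smallest real root of $\eta=\mathcal L_{G_i}(\mu_i(1-\eta))$, where $\mathcal L_{G_i}(s)=\int e^{-sx}\,dG_i(x)$. Then $\eta_i$ exists, $\eta_i<1$, all the delays are integrable, $$\mathbb E[D_n^{[0]}]=\frac1{\mu_0}+\frac1{\mu_0}\cdot\frac{-\rho_0\mathcal W(-\frac1{\rho_0}e^{-1/\rho_0})}{1+\rho_0\mathcal W(-\frac1{\rho_0}e^{-1/\rho_0})},\qquad \mathbb E[D_n^{[i]}]=\frac1{\mu_i}+\frac{\eta_i}{\mu_i(1-\eta_i)}\quad(i=1,2),$$ $$\overline\Delta^{[i]}=\frac1{2\lambda_0}+\mathbb E\Big[\frac{\Phi_n}{S_n}\Big]+\mathbb E[D_n^{[0]}]+\mathbb E[D_n^{[i]}]=\frac1{2\lambda_0}+\mathbb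 E\Big[\frac{\Phi_n}{S_n}\Big]+\frac{\mu_0+\mu_i}{\mu_0\mu_i}+\frac1{\mu_0}\cdot\frac{-\rho_0\mathcal W(-\frac1{\rho_0}e^{-1/\rho_0})}{1+\rho_0\mathcal W(-\frac1{\rho_0}e^{-1/\rho_0})}+\frac{\eta_i}{\mu_i(1-\eta_i)},$$ and $\overline\Delta=a\,\overline\Delta^{[1]}+b\,\overline\Delta^{[2]}$. Moreover, for each of these three streams of updates (all served by server $1$; all served by server $2$; each served according to its category): if almost surely the updates leave the system in the order of generation and $\frac1N\sum_{n=1}^{N}Q_n\to\mathbb E[Q_n]$, then almost surely the time average $\frac1{\mathcal T}\int_0^{\mathcal T}A(t)\,dt$ of the age $A(t)$ (the time elapsed at $t$ since the generation of the latest update received by time $t$; $A(t)=t$ before the first reception) converges, as $\mathcal T\to\infty$, to $\overline\Delta^{[1]}$, $\overline\Delta^{[2]}$, $\overline\Delta$ respectively. -/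

import Mathlib

open MeasureTheory ProbabilityTheory Filter Topology

noncomputable section

namespace AoI

/-- The principal real branch of the Lambert `W` function: the inverse of `w ↦ w * exp w`
restricted to `[-1, ∞)`. -/
def lambertW (x : ℝ) : ℝ :=
  Function.invFunOn (fun w : ℝ => w * Real.exp w) (Set.Ici (-1)) x

/-- The Laplace transform `s ↦ E[exp (-s X)]` of a distribution `G` on the line. -/
def laplace (G : Measure ℝ) (s : ℝ) : ℝ := ∫ x, Real.exp (-(s * x)) ∂G

/-- The set of real roots `x` of `x = L_G (μ (1 - x))`. -/
def rootSet (G : Measure ℝ) (μ : ℝ) : Set ℝ := {x | x = laplace G (μ * (1 - x))}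

/-- The smallest root of `x = L_G (μ (1 - x))`. -/
def smallestRoot (G : Measure ℝ) (μ : ℝ) : ℝ := sInf (rootSet G μ)

/-- A first-come-first-served single-server G/M/1 queue in steady state.
`A n` is the time between the arrivals of packets `n` and `n + 1`, `H n` is the service time of
packet `n`, and `W n` is its waiting time. The inter-arrival times are i.i.d. with law `G`, the
service times are i.i.d. exponential with rate `μ`, the two sequences and the initial waiting time
are independent, the waiting times follow the Lindley recursion, and their law does not depend
on the packet. -/
structure IsSteadyGM1 {Ω : Type*} [MeasurableSpace Ω] (P : Measure Ω) (G : Measure ℝ) (μ : ℝ)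
    (A H W : ℕ → Ω → ℝ) : Prop where
  measurable_A : ∀ n, Measurable (A n)
  measurable_H : ∀ n, Measurable (H n)
  measurable_W : ∀ n, Measurable (W n)
  law_A : ∀ n, P.map (A n) = G
  law_H : ∀ n, P.map (H n) = expMeasure μ
  indep_A_H : ∀ n, IndepFun (A n) (H n) P
  indep_packets : iIndepFun (fun n ω => (A n ω, H n ω)) P
  indep_initial : IndepFun (W 0) (fun ω n => (A n ω, H n ω)) P
  initial_nonneg : ∀ ω, 0 ≤ W 0 ω
  lindley : ∀ n ω, W (n + 1) ω = max 0 (W n ω + H n ω - A n ω)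
  steady : ∀ n, P.map (W n) = P.map (W 0)

/-- A D/M/1 queue in steady state with arrival rate `lam`, that is, a G/M/1 queue
whose inter-arrival times are all equal to `1 / lam`. -/
def IsSteadyDM1 {Ω : Type*} [MeasurableSpace Ω] (P : Measure Ω) (lam μ : ℝ)
    (H W : ℕ → Ω → ℝ) : Prop :=
  IsSteadyGM1 P (Measure.dirac (1 / lam)) μ (fun _ _ => 1 / lam) H W

/-- The delay (waiting time plus service time) in one component. -/
def sojourn {Ω : Type*} (W H : ℕ → Ω → ℝ) (n : ℕ) (ω : Ω) : ℝ := W n ω + H n ω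

/-- The category of an update with semantic similarity `x`, for the category boundary `ξhat`:
`0` stands for Category I (`x ≥ ξhat`), `1` for Category II (`x < ξhat`). -/
def category (ξhat x : ℝ) : Fin 2 := if ξhat ≤ x then 0 else 1

/-- Generation moment of update `n`, for generation rate `lam`. -/
def genTime (lam : ℝ) (n : ℕ) : ℝ := n / lam

/-- The time between the generation of updates `n` and `n + 1`. -/
def genInterval (lam : ℝ) (n : ℕ) : ℝ := genTime lam (n + 1) - genTime lam n

/-- The area `Q` that an update with system delay `d`, generated `g` after the
previous one, contributes to the area under the age curve. -/
def polygonArea (g d : ℝ) : ℝ := (g + d) ^ 2 / 2 - d ^ 2 / 2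

/-- The expectation `E[Q]` for update `n + 1`, if `D` are the system delays. -/
def meanArea {Ω : Type*} [MeasurableSpace Ω] (P : Measure Ω) (lam : ℝ) (D : ℕ → Ω → ℝ)
    (n : ℕ) : ℝ :=
  ∫ ω, polygonArea (genInterval lam n) (D (n + 1) ω) ∂P

/-- The average age of information `E[Q] / E[G]` at update `n + 1`, if updates are
generated with rate `lam` and have system delays `D`. -/
def averageAoI {Ω : Type*} [MeasurableSpace Ω] (P : Measure Ω) (lam : ℝ) (D : ℕ → Ω → ℝ)
    (n : ℕ) : ℝ :=
  meanArea P lam D n / ∫ _ω, genInterval lam n ∂P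

/-- The instantaneous age at time `t`: the time elapsed since the generation of the latest of the
updates received by time `t`, where update `n` is generated at `α n` and received at `β n`.
(Before the first reception the age is `t`.) -/
def age (α β : ℕ → ℝ) (t : ℝ) : ℝ := t - sSup {x | ∃ n, β n ≤ t ∧ x = α n}

/-- Moment at which update `n` leaves the system, if `d` are the system delays. -/
def departure (lam : ℝ) (d : ℕ → ℝ) (n : ℕ) : ℝ := genTime lam n + d n

/-- The time average of the age over `[0, τ]`, if `d` are the system delays. -/
def timeAverageAge (lam : ℝ) (d : ℕ → ℝ) (τ : ℝ) : ℝ :=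
  (1 / τ) * ∫ t in (0 : ℝ)..τ, age (genTime lam) (departure lam d) t

/-- Updates almost surely leave the system in the order of their generation. -/
def DeparturesOrdered {Ω : Type*} [MeasurableSpace Ω] (P : Measure Ω) (lam : ℝ)
    (D : ℕ → Ω → ℝ) : Prop :=
  ∀ᵐ ω ∂P, Monotone (departure lam fun n => D n ω)

/-- The areas `Q` are ergodic: almost surely their empirical mean tends to `E[Q]`. -/
def AreasErgodic {Ω : Type*} [MeasurableSpace Ω] (P : Measure Ω) (lam : ℝ)
    (D : ℕ → Ω → ℝ) : Prop :=
  ∀ᵐ ω ∂P, Tendsto (fun N : ℕ =>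
      (1 / (N : ℝ)) * ∑ n ∈ Finset.range N, polygonArea (genInterval lam n) (D (n + 1) ω))
    atTop (𝓝 (meanArea P lam D 0))

/-- System delay of update `n` if it is served by a server with delays `Dserv`: the transmission
time (packet volume over semantic rate), plus the delay `Dsched` in the scheduler, plus the delay
in the server. -/
def systemDelay {Ω : Type*} (Φ S Dsched Dserv : ℕ → Ω → ℝ) (n : ℕ) (ω : Ω) : ℝ :=
  Φ n ω / S n ω + Dsched n ω + Dserv n ω

end AoI

end

/-
With `α n` and `β n` the generation and reception times of update `n`, integrating the age by parts
gives `∫₀^τ age = (τ - α N)² / 2 + ∑_{n < N} Q n` for the number `N` of updates received by time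
`τ`. Taking for `N` the number of updates generated by time `τ` instead turns this into an upper
bound with a bounded square. Both numbers grow like `lam * τ`, so the time average of the age tends
to `lam * E[Q]`.

For the G/M/1 queue, the mixture of an atom at `0` and an exponential law, convolved with the law of
a service time, is again exponential; for a root `η < 1` of `η = L_G (μ (1 - η))` this makes the
mixture with weight `η` a fixed point of Lindley's recursion. The absolute difference of the
survival functions of two fixed points is bounded, vanishes at `+∞` and is subharmonic for a random
walk with negative drift, hence it is zero. So the stationary waiting time has this mixture as its
law, and there is only one root below `1`. For deterministic arrivals the equation for `η` is of the
form `v * exp v = c`.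
-/

namespace AoI

section AgePath

variable {α β : ℕ → ℝ} {t τ : ℝ} {n K N : ℕ}

/-- The number of updates after update `0` that are received by time `τ`, if update `n` is received
at `β n` and `β` is monotone and unbounded. -/
noncomputable def received (β : ℕ → ℝ) (τ : ℝ) : ℕ := sInf {n | τ < β (n + 1)}

lemma lt_received_add_one (h : ∃ n, τ < β (n + 1)) : τ < β (received β τ + 1) :=
  Nat.sInf_mem h

lemma le_of_lt_received (h : n < received β τ) : β (n + 1) ≤ τ :=
  not_lt.1 (Nat.notMem_of_lt_sInf h)

lemma received_le (h : τ < β (n + 1)) : received β τ ≤ n :=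
  Nat.sInf_le h

lemma le_iff_le_received (hβ : Monotone β) (h : ∃ n, τ < β (n + 1)) (h0 : β 0 ≤ τ) :
    β n ≤ τ ↔ n ≤ received β τ := by
  refine ⟨fun hn => ?_, fun hn => ?_⟩
  · by_contra! hlt
    exact absurd ((lt_received_add_one h).trans_le (hβ hlt)) hn.not_gt
  · cases n with
    | zero => exact h0
    | succ k => exact le_of_lt_received hn

lemma sSup_received_eq_sum (hα : Monotone α) (hα0 : α 0 = 0) (hβ : Monotone β)
    (hK : t < β (K + 1)) :
    sSup {x | ∃ n, β n ≤ t ∧ x = α n}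
      = ∑ k ∈ Finset.range K, if β (k + 1) ≤ t then α (k + 1) - α k else 0 := by
  rcases le_or_gt (β 0) t with h0 | h0
  · have hiff : ∀ n, β n ≤ t ↔ n ≤ received β t := fun n => le_iff_le_received hβ ⟨K, hK⟩ h0
    have hgreatest : IsGreatest {x | ∃ n, β n ≤ t ∧ x = α n} (α (received β t)) := by
      refine ⟨⟨_, (hiff _).2 le_rfl, rfl⟩, ?_⟩
      rintro x ⟨n, hn, rfl⟩
      exact hα ((hiff n).1 hn)
    have hrange : {k ∈ Finset.range K | k + 1 ≤ received β t} = Finset.range (received β t) := by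
      grind
    rw [hgreatest.csSup_eq]
    simp only [hiff, ← Finset.sum_filter, hrange, Finset.sum_range_sub, hα0, sub_zero]
  · have hnone : ∀ n, ¬ β n ≤ t := fun n => (h0.trans_le (hβ n.zero_le)).not_ge
    simp [hnone]

lemma intervalIntegrable_ite_le (b c x y : ℝ) :
    IntervalIntegrable (fun t => if b ≤ t then c else 0) volume x y :=
  (intervalIntegrable_const (c := |c|)).mono_fun
    (Measurable.ite measurableSet_Ici measurable_const measurable_const).aestronglyMeasurable
    (Eventually.of_forall fun t => by dsimp only; split_ifs <;> simp)

lemma integral_ite_le {b : ℝ} (hb : 0 ≤ b) (hτ : 0 ≤ τ) (c : ℝ) :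
    ∫ t in (0 : ℝ)..τ, (if b ≤ t then c else 0) = c * max 0 (τ - b) := by
  have hindicator : (fun t => if b ≤ t then c else 0) = (Set.Ici b).indicator fun _ => c := by
    ext t
    simp [Set.indicator]
  rw [hindicator, intervalIntegral.integral_of_le hτ, setIntegral_indicator measurableSet_Ici,
    setIntegral_congr_set ((ae_eq_refl _).inter Ioi_ae_eq_Ici.symm), Set.Ioc_inter_Ioi,
    max_eq_right hb, setIntegral_const, smul_eq_mul, mul_comm, Real.volume_real_Ioc, max_comm]

lemma integral_age (hα : Monotone α) (hα0 : α 0 = 0) (hβ : Monotone β) (hβ0 : 0 ≤ β 0)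
    (hτ : 0 ≤ τ) (hK : τ < β (K + 1)) :
    ∫ t in (0 : ℝ)..τ, age α β t
      = τ ^ 2 / 2 - ∑ k ∈ Finset.range K, (α (k + 1) - α k) * max 0 (τ - β (k + 1)) := by
  have hage : Set.EqOn (age α β)
      (fun t => t - ∑ k ∈ Finset.range K, if β (k + 1) ≤ t then α (k + 1) - α k else 0)
      (Set.uIcc 0 τ) := fun t ht => by
    rw [Set.uIcc_of_le hτ] at ht
    simp only [age, sSup_received_eq_sum hα hα0 hβ (ht.2.trans_lt hK)]
  have hint : ∀ k ∈ Finset.range K, IntervalIntegrable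
      (fun t => if β (k + 1) ≤ t then α (k + 1) - α k else 0) volume 0 τ :=
    fun k _ => intervalIntegrable_ite_le _ _ _ _
  rw [intervalIntegral.integral_congr hage,
    intervalIntegral.integral_sub intervalIntegral.intervalIntegrable_id
      (by simpa only [Finset.sum_fn] using IntervalIntegrable.sum _ hint),
    intervalIntegral.integral_finsetSum hint, integral_id,
    Finset.sum_congr rfl fun k _ => integral_ite_le (hβ0.trans (hβ (k + 1).zero_le)) hτ _]
  ring

lemma sq_div_two_sub_sum (hα0 : α 0 = 0) (τ : ℝ) (N : ℕ) :
    τ ^ 2 / 2 - ∑ k ∈ Finset.range N, (α (k + 1) - α k) * (τ - β (k + 1))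
      = (τ - α N) ^ 2 / 2 + ∑ k ∈ Finset.range N,
        polygonArea (α (k + 1) - α k) (β (k + 1) - α (k + 1)) := by
  induction N with
  | zero => simp [hα0]
  | succ N ih =>
    rw [Finset.sum_range_succ, Finset.sum_range_succ, ← sub_sub, ih, polygonArea]
    ring

lemma integral_age_le (hα : Monotone α) (hα0 : α 0 = 0) (hβ : Monotone β) (hβ0 : 0 ≤ β 0)
    (hτ : 0 ≤ τ) (hN : τ < β (N + 1)) :
    ∫ t in (0 : ℝ)..τ, age α β t ≤ (τ - α N) ^ 2 / 2
      + ∑ k ∈ Finset.range N, polygonArea (α (k + 1) - α k) (β (k + 1) - α (k + 1)) := by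
  rw [integral_age hα hα0 hβ hβ0 hτ hN, ← sq_div_two_sub_sum hα0]
  gcongr with k
  · exact sub_nonneg.2 (hα k.le_succ)
  · exact le_max_right _ _

lemma sum_polygonArea_received_le (hα : Monotone α) (hα0 : α 0 = 0) (hβ : Monotone β)
    (hβ0 : 0 ≤ β 0) (hτ : 0 ≤ τ) (h : ∃ n, τ < β (n + 1)) :
    ∑ k ∈ Finset.range (received β τ), polygonArea (α (k + 1) - α k) (β (k + 1) - α (k + 1))
      ≤ ∫ t in (0 : ℝ)..τ, age α β t := by
  have hmax : ∀ k ∈ Finset.range (received β τ),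
      (α (k + 1) - α k) * max 0 (τ - β (k + 1)) = (α (k + 1) - α k) * (τ - β (k + 1)) :=
    fun k hk => by
      rw [max_eq_right (sub_nonneg.2 (le_of_lt_received (Finset.mem_range.1 hk)))]
  rw [integral_age hα hα0 hβ hβ0 hτ (lt_received_add_one h), Finset.sum_congr rfl hmax,
    sq_div_two_sub_sum hα0]
  exact le_add_of_nonneg_left (by positivity)

end AgePath

section Asymptotics

variable {β u : ℕ → ℝ} {c q : ℝ}

lemma tendsto_natCast_add_one_div : Tendsto (fun n : ℕ => ((n : ℝ) + 1) / n) atTop (𝓝 1) := by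
  simpa using (tendsto_natCast_div_add_atTop (1 : ℝ)).inv₀ one_ne_zero

lemma tendsto_atTop_of_tendsto_div (hc : 0 < c)
    (hβ : Tendsto (fun n : ℕ => β n / n) atTop (𝓝 c)) : Tendsto β atTop atTop := by
  refine (tendsto_natCast_atTop_atTop.atTop_mul_pos hc hβ).congr' ?_
  filter_upwards [eventually_gt_atTop 0] with n hn
  field_simp

lemma exists_lt_add_one (htop : Tendsto β atTop atTop) (x : ℝ) : ∃ n, x < β (n + 1) :=
  ((htop.comp (tendsto_add_atTop_nat 1)).eventually_gt_atTop x).exists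

lemma tendsto_received_atTop (hβ : Monotone β) (htop : Tendsto β atTop atTop) :
    Tendsto (received β) atTop atTop := by
  refine tendsto_atTop.2 fun m => ?_
  filter_upwards [eventually_ge_atTop (β m)] with τ hτ
  exact (le_iff_le_received hβ (exists_lt_add_one htop τ) ((hβ m.zero_le).trans hτ)).1 hτ

lemma tendsto_received_div (hmono : Monotone β) (hc : 0 < c)
    (hβ : Tendsto (fun n : ℕ => β n / n) atTop (𝓝 c)) :
    Tendsto (fun τ : ℝ => (received β τ : ℝ) / τ) atTop (𝓝 c⁻¹) := by
  have htop := tendsto_atTop_of_tendsto_div hc hβ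
  have hN := tendsto_received_atTop hmono htop
  have hnext : Tendsto (fun n : ℕ => β (n + 1) / n) atTop (𝓝 c) := by
    have h := (hβ.comp (tendsto_add_atTop_nat 1)).mul tendsto_natCast_add_one_div
    rw [mul_one] at h
    refine h.congr fun n => ?_
    simp only [Function.comp, Nat.cast_add_one]
    field_simp
  suffices h : Tendsto (fun τ : ℝ => τ / received β τ) atTop (𝓝 c) by
    simpa only [inv_div] using h.inv₀ hc.ne'
  refine tendsto_of_tendsto_of_tendsto_of_le_of_le' (hβ.comp hN) (hnext.comp hN) ?_ ?_
  all_goals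
    filter_upwards [eventually_ge_atTop (β 0)] with τ h0
    have h := exists_lt_add_one htop τ
    simp only [Function.comp]
    gcongr
  · exact (le_iff_le_received hmono h h0).2 le_rfl
  · exact (lt_received_add_one h).le

lemma tendsto_div_of_tendsto_average
    (hu : Tendsto (fun N : ℕ => (1 / (N : ℝ)) * ∑ n ∈ Finset.range N, u n) atTop (𝓝 q)) :
    Tendsto (fun n : ℕ => u n / n) atTop (𝓝 0) := by
  have h := (tendsto_natCast_add_one_div.mul (hu.comp (tendsto_add_atTop_nat 1))).sub hu
  rw [one_mul, sub_self] at h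
  refine h.congr fun n => ?_
  simp only [Function.comp, Finset.sum_range_succ, Nat.cast_add_one]
  field_simp
  ring

lemma tendsto_sum_range_div
    (hu : Tendsto (fun N : ℕ => (1 / (N : ℝ)) * ∑ n ∈ Finset.range N, u n) atTop (𝓝 q))
    {N : ℝ → ℕ} (hN : Tendsto N atTop atTop)
    (hNc : Tendsto (fun τ : ℝ => (N τ : ℝ) / τ) atTop (𝓝 c)) :
    Tendsto (fun τ : ℝ => (∑ n ∈ Finset.range (N τ), u n) / τ) atTop (𝓝 (q * c)) := by
  refine ((hu.comp hN).mul hNc).congr' ?_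
  filter_upwards [hN.eventually_gt_atTop 0] with τ hτ
  simp only [Function.comp]
  field_simp

end Asymptotics

section TimeAverage

variable {lam : ℝ} {d : ℕ → ℝ} {q : ℝ}

lemma genInterval_eq (lam : ℝ) (n : ℕ) : genInterval lam n = 1 / lam := by
  simp only [genInterval, genTime, Nat.cast_add_one]
  ring

lemma polygonArea_eq (g d : ℝ) : polygonArea g d = g ^ 2 / 2 + g * d := by
  unfold polygonArea
  ring

lemma monotone_genTime (hlam : 0 < lam) : Monotone (genTime lam) := fun m n hmn => by
  unfold genTime
  gcongr

lemma genTime_zero (lam : ℝ) : genTime lam 0 = 0 := by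
  simp [genTime]

lemma tendsto_genTime_div (lam : ℝ) :
    Tendsto (fun n : ℕ => genTime lam n / n) atTop (𝓝 (1 / lam)) := by
  refine tendsto_const_nhds.congr' ?_
  filter_upwards [eventually_gt_atTop 0] with n hn
  rw [genTime]
  field_simp

lemma tendsto_delay_div (hlam : 0 < lam)
    (hq : Tendsto (fun N : ℕ =>
      (1 / (N : ℝ)) * ∑ n ∈ Finset.range N, polygonArea (genInterval lam n) (d (n + 1)))
      atTop (𝓝 q)) :
    Tendsto (fun n : ℕ => d n / n) atTop (𝓝 0) := by
  have harea : Tendsto (fun n : ℕ => d (n + 1) / n) atTop (𝓝 0) := by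
    have h := ((tendsto_div_of_tendsto_average hq).const_mul lam).sub
      (tendsto_one_div_atTop_nhds_zero_nat.const_mul (1 / lam / 2))
    rw [mul_zero, mul_zero, sub_zero] at h
    refine h.congr fun n => ?_
    rw [polygonArea_eq, genInterval_eq]
    field_simp
    ring
  have h := harea.mul (tendsto_natCast_div_add_atTop (1 : ℝ))
  rw [zero_mul] at h
  refine (tendsto_add_atTop_iff_nat 1).1 (h.congr' ?_)
  filter_upwards [eventually_gt_atTop 0] with n hn
  rw [Nat.cast_add_one]
  field_simp

lemma tendsto_departure_div (hlam : 0 < lam)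
    (hq : Tendsto (fun N : ℕ =>
      (1 / (N : ℝ)) * ∑ n ∈ Finset.range N, polygonArea (genInterval lam n) (d (n + 1)))
      atTop (𝓝 q)) :
    Tendsto (fun n : ℕ => departure lam d n / n) atTop (𝓝 (1 / lam)) := by
  have h := (tendsto_genTime_div lam).add (tendsto_delay_div hlam hq)
  simpa only [departure, add_div, add_zero] using h

lemma integral_age_departure_le (hlam : 0 < lam) (hd : ∀ n, 0 ≤ d n)
    (hmono : Monotone (departure lam d)) {τ : ℝ} (hτ : 0 ≤ τ) :
    ∫ t in (0 : ℝ)..τ, age (genTime lam) (departure lam d) t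
      ≤ (1 / lam) ^ 2 / 2 + ∑ n ∈ Finset.range (received (genTime lam) τ),
        polygonArea (genInterval lam n) (d (n + 1)) := by
  have hgen := monotone_genTime hlam
  have htop := tendsto_atTop_of_tendsto_div (one_div_pos.2 hlam) (tendsto_genTime_div lam)
  have hex := exists_lt_add_one htop τ
  have hle : genTime lam (received (genTime lam) τ) ≤ τ :=
    (le_iff_le_received hgen hex ((genTime_zero lam).trans_le hτ)).2 le_rfl
  have hlt := lt_received_add_one hex
  have hstep := genInterval_eq lam (received (genTime lam) τ)
  rw [genInterval] at hstep
  have hsq : (τ - genTime lam (received (genTime lam) τ)) ^ 2 / 2 ≤ (1 / lam) ^ 2 / 2 := by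
    gcongr
    linarith
  have hage := integral_age_le hgen (genTime_zero lam) hmono
    (by simpa [departure, genTime] using hd 0) hτ (hlt.trans_le (le_add_of_nonneg_right (hd _)))
  simp only [departure, add_sub_cancel_left] at hage
  exact hage.trans (add_le_add_left hsq _)

lemma sum_polygonArea_le_integral_age_departure (hlam : 0 < lam) (hd : ∀ n, 0 ≤ d n)
    (hmono : Monotone (departure lam d)) {τ : ℝ} (hτ : 0 ≤ τ)
    (h : ∃ n, τ < departure lam d (n + 1)) :
    ∑ n ∈ Finset.range (received (departure lam d) τ), polygonArea (genInterval lam n) (d (n + 1))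
      ≤ ∫ t in (0 : ℝ)..τ, age (genTime lam) (departure lam d) t := by
  simpa [departure, genInterval] using sum_polygonArea_received_le (monotone_genTime hlam)
    (genTime_zero lam) hmono (by simpa [departure, genTime] using hd 0) hτ h

lemma tendsto_timeAverageAge (hlam : 0 < lam) (hd : ∀ n, 0 ≤ d n)
    (hmono : Monotone (departure lam d))
    (hq : Tendsto (fun N : ℕ =>
      (1 / (N : ℝ)) * ∑ n ∈ Finset.range N, polygonArea (genInterval lam n) (d (n + 1)))
      atTop (𝓝 q)) :
    Tendsto (timeAverageAge lam d) atTop (𝓝 (q * lam)) := by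
  have hlam' : 0 < 1 / lam := one_div_pos.2 hlam
  have hareas : ∀ {β : ℕ → ℝ}, Monotone β →
      Tendsto (fun n : ℕ => β n / n) atTop (𝓝 (1 / lam)) →
      Tendsto (fun τ : ℝ => (∑ n ∈ Finset.range (received β τ),
        polygonArea (genInterval lam n) (d (n + 1))) / τ) atTop (𝓝 (q * lam)) :=
    fun hβ hdiv => by
      simpa only [one_div, inv_inv] using tendsto_sum_range_div hq
        (tendsto_received_atTop hβ (tendsto_atTop_of_tendsto_div hlam' hdiv))
        (tendsto_received_div hβ hlam' hdiv)
  have hdep := tendsto_departure_div hlam hq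
  have hupper := ((tendsto_inv_atTop_zero (𝕜 := ℝ)).const_mul ((1 / lam) ^ 2 / 2)).add
    (hareas (monotone_genTime hlam) (tendsto_genTime_div lam))
  rw [mul_zero, zero_add] at hupper
  refine tendsto_of_tendsto_of_tendsto_of_le_of_le' (hareas hmono hdep) hupper ?_ ?_
  all_goals
    filter_upwards [eventually_gt_atTop 0] with τ hτ
    rw [timeAverageAge, one_div_mul_eq_div]
  · have hex := exists_lt_add_one (tendsto_atTop_of_tendsto_div hlam' hdep) τ
    gcongr
    exact sum_polygonArea_le_integral_age_departure hlam hd hmono hτ.le hex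
  · rw [← div_eq_mul_inv, ← add_div]
    gcongr
    exact integral_age_departure_le hlam hd hmono hτ.le

end TimeAverage

section Survival

variable {ν κ : Measure ℝ} {x : ℝ}

/-- The survival function `x ↦ ν (x, ∞)` of a distribution on the line, in which Lindley's
recursion is linear on `[0, ∞)`. -/
noncomputable def survival (ν : Measure ℝ) (x : ℝ) : ℝ := ν.real (Set.Ioi x)

lemma measurable_survival [IsFiniteMeasure ν] : Measurable (survival ν) :=
  Antitone.measurable fun _ _ h => measureReal_mono (Set.Ioi_subset_Ioi h)

lemma survival_eq_one_sub_cdf [IsProbabilityMeasure ν] (x : ℝ) : survival ν x = 1 - cdf ν x := by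
  rw [survival, ← Set.compl_Iic, probReal_compl_eq_one_sub measurableSet_Iic, cdf_eq_real]

lemma tendsto_survival_atTop [IsProbabilityMeasure ν] : Tendsto (survival ν) atTop (𝓝 0) := by
  simpa [funext (survival_eq_one_sub_cdf (ν := ν))] using (tendsto_cdf_atTop ν).const_sub 1

lemma eq_of_survival [IsProbabilityMeasure ν] [IsProbabilityMeasure κ]
    (h : survival ν = survival κ) : ν = κ := by
  refine Measure.eq_of_cdf ν κ (StieltjesFunction.ext fun x => ?_)
  have := congrFun h x
  rwa [survival_eq_one_sub_cdf, survival_eq_one_sub_cdf, sub_right_inj] at this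

lemma survival_nonneg : 0 ≤ survival ν x := measureReal_nonneg

lemma survival_le_one [IsProbabilityMeasure ν] : survival ν x ≤ 1 := measureReal_le_one

lemma abs_survival_sub_le_one [IsProbabilityMeasure ν] [IsProbabilityMeasure κ] (x : ℝ) :
    |survival ν x - survival κ x| ≤ 1 :=
  abs_sub_le_of_nonneg_of_le survival_nonneg survival_le_one survival_nonneg survival_le_one

lemma integrable_survival_sub [IsProbabilityMeasure ν] [IsFiniteMeasure κ] (x : ℝ) :
    Integrable (fun u => survival ν (x - u)) κ :=
  Integrable.of_bound (measurable_survival.comp (by fun_prop)).aestronglyMeasurable 1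
    (Eventually.of_forall fun _ =>
      (Real.norm_of_nonneg survival_nonneg).trans_le survival_le_one)

lemma survival_conv [IsProbabilityMeasure ν] [IsProbabilityMeasure κ] (x : ℝ) :
    survival (ν ∗ κ) x = ∫ u, survival ν (x - u) ∂κ := by
  have hint : Integrable ((Set.Ioi x).indicator (1 : ℝ → ℝ)) (κ ∗ ν) :=
    (integrable_const 1).indicator measurableSet_Ioi
  rw [survival, Measure.conv_comm, ← integral_indicator_one measurableSet_Ioi, integral_conv hint]
  refine integral_congr_ae (Eventually.of_forall fun u => ?_)
  have hshift : (fun y => (Set.Ioi x).indicator (1 : ℝ → ℝ) (u + y))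
      = (Set.Ioi (x - u)).indicator 1 := by
    ext y
    simp [Set.indicator, sub_lt_iff_lt_add']
  simp only [hshift, integral_indicator_one measurableSet_Ioi, survival]

end Survival

section Walk

variable {ν κ : Measure ℝ} {h : ℝ → ℝ} {C : ℝ}

lemma integral_sub_le_integral_sub_conv [IsProbabilityMeasure ν] [IsProbabilityMeasure κ]
    (hm : Measurable h) (hb : ∀ x, |h x| ≤ C)
    (hsub : ∀ x, h x ≤ ∫ u, h (x - u) ∂κ) (x : ℝ) :
    ∫ s, h (x - s) ∂ν ≤ ∫ s, h (x - s) ∂(ν ∗ κ) := by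
  have hbdd : ∀ (ρ : Measure ℝ) [IsProbabilityMeasure ρ], Integrable (fun s => h (x - s)) ρ :=
    fun ρ _ => Integrable.of_bound (hm.comp (by fun_prop)).aestronglyMeasurable C
      (Eventually.of_forall fun s => hb _)
  have hprod : Integrable (fun p : ℝ × ℝ => h (x - (p.1 + p.2))) (ν.prod κ) :=
    Integrable.of_bound (hm.comp (by fun_prop)).aestronglyMeasurable C
      (Eventually.of_forall fun p => hb _)
  rw [integral_conv (hbdd (ν ∗ κ))]
  exact integral_mono (hbdd ν) hprod.integral_prod_left fun s => by
    simpa only [sub_sub] using hsub (x - s)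

variable {Ω : Type*} [MeasurableSpace Ω] {P : Measure Ω} {X : ℕ → Ω → ℝ}

lemma le_integral_sub_sum_range [IsProbabilityMeasure P] [IsProbabilityMeasure κ]
    (hX : ∀ n, Measurable (X n))
    (hlaw : ∀ n, HasLaw (X n) κ P) (hindep : iIndepFun X P) (hm : Measurable h)
    (hb : ∀ x, |h x| ≤ C) (hsub : ∀ x, h x ≤ ∫ u, h (x - u) ∂κ) (x : ℝ) (n : ℕ) :
    h x ≤ ∫ ω, h (x - (∑ i ∈ Finset.range n, X i) ω) ∂P := by
  have hS : ∀ n, Measurable (∑ i ∈ Finset.range n, X i) := fun n => by fun_prop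
  have hmx : Measurable fun s => h (x - s) := hm.comp (by fun_prop)
  induction n with
  | zero => simp
  | succ n ih =>
    have := Measure.isProbabilityMeasure_map (μ := P) (hS n).aemeasurable
    have hstep : P.map (∑ i ∈ Finset.range (n + 1), X i)
        = P.map (∑ i ∈ Finset.range n, X i) ∗ κ := by
      rw [Finset.sum_range_succ, (hindep.indepFun_sum_range_succ hX n).map_add_eq_map_conv_map
        (hS n) (hX n), (hlaw n).map_eq]
    refine ih.trans ?_
    rw [← integral_map (hS n).aemeasurable hmx.aestronglyMeasurable,
      ← integral_map (hS (n + 1)).aemeasurable hmx.aestronglyMeasurable, hstep]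
    exact integral_sub_le_integral_sub_conv hm hb hsub x

lemma ae_tendsto_sum_range_atBot (hlaw : ∀ n, HasLaw (X n) κ P)
    (hindep : iIndepFun X P) (hneg : ∫ u, u ∂κ < 0) :
    ∀ᵐ ω ∂P, Tendsto (fun n => (∑ i ∈ Finset.range n, X i) ω) atTop atBot := by
  have hmean : ∫ ω, X 0 ω ∂P < 0 := (hlaw 0).integral_eq.trans_lt hneg
  filter_upwards [strong_law_ae_real X (Integrable.of_integral_ne_zero hmean.ne)
    (fun i j hij => hindep.indepFun hij)
    (fun i => ⟨(hlaw i).aemeasurable, (hlaw 0).aemeasurable,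
      (hlaw i).map_eq.trans (hlaw 0).map_eq.symm⟩)] with ω hω
  refine ((tendsto_natCast_atTop_atTop (R := ℝ)).atTop_mul_neg hmean hω).congr' ?_
  filter_upwards [eventually_gt_atTop 0] with n hn
  rw [Finset.sum_apply]
  field_simp

lemma nonpos_of_le_integral_sub [IsProbabilityMeasure κ] (hneg : ∫ u, u ∂κ < 0)
    (hm : Measurable h) (hb : ∀ x, |h x| ≤ C)
    (hlim : Tendsto h atTop (𝓝 0)) (hsub : ∀ x, h x ≤ ∫ u, h (x - u) ∂κ) (x : ℝ) : h x ≤ 0 := by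
  obtain ⟨Ω, _, P, X, hX, hlaw, hindep, _⟩ := exists_iid ℕ κ
  have hto : Tendsto (fun n : ℕ => ∫ ω, h (x - (∑ i ∈ Finset.range n, X i) ω) ∂P) atTop
      (𝓝 (∫ _, (0 : ℝ) ∂P)) := by
    refine tendsto_integral_of_dominated_convergence (fun _ => C)
      (fun n => (hm.comp (by fun_prop)).aestronglyMeasurable)
      (integrable_const C) (fun n => Eventually.of_forall fun ω => hb _) ?_
    filter_upwards [ae_tendsto_sum_range_atBot hlaw hindep hneg] with ω hω
    exact hlim.comp (tendsto_atTop_add_const_left _ x (tendsto_neg_atBot_atTop.comp hω))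
  rw [integral_zero] at hto
  exact ge_of_tendsto' hto fun n => le_integral_sub_sum_range hX hlaw hindep hm hb hsub x n

end Walk

section Lindley

variable {ν ν₁ ν₂ κ : Measure ℝ} {x : ℝ}

/-- The law of `max 0 (W + X)`, for independent `W` with law `ν` and `X` with law `κ`: the law of
the next waiting time, if service time minus inter-arrival time has law `κ`. -/
noncomputable def lindleyStep (κ ν : Measure ℝ) : Measure ℝ := (ν ∗ κ).map fun y => max 0 y

lemma survival_lindleyStep_of_nonneg (hx : 0 ≤ x) :
    survival (lindleyStep κ ν) x = survival (ν ∗ κ) x := by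
  have hpre : (fun y : ℝ => max 0 y) ⁻¹' Set.Ioi x = Set.Ioi x := by
    ext y
    simp [hx.not_gt]
  rw [survival, lindleyStep, map_measureReal_apply (by fun_prop) measurableSet_Ioi, hpre, survival]

lemma survival_lindleyStep_of_neg [IsProbabilityMeasure ν] [IsProbabilityMeasure κ] (hx : x < 0) :
    survival (lindleyStep κ ν) x = 1 := by
  have hpre : (fun y : ℝ => max 0 y) ⁻¹' Set.Ioi x = Set.univ := by
    ext y
    simp [hx]
  rw [survival, lindleyStep, map_measureReal_apply (by fun_prop) measurableSet_Ioi, hpre,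
    probReal_univ]

theorem eq_of_lindleyStep_eq [IsProbabilityMeasure κ] [IsProbabilityMeasure ν₁]
    [IsProbabilityMeasure ν₂] (hneg : ∫ u, u ∂κ < 0) (h₁ : lindleyStep κ ν₁ = ν₁)
    (h₂ : lindleyStep κ ν₂ = ν₂) : ν₁ = ν₂ := by
  set h : ℝ → ℝ := fun x => |survival ν₁ x - survival ν₂ x| with hdef
  have hlim : Tendsto h atTop (𝓝 0) := by
    simpa using (tendsto_survival_atTop.sub tendsto_survival_atTop).abs
  have hsub : ∀ x, h x ≤ ∫ u, h (x - u) ∂κ := fun x => by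
    rcases lt_or_ge x 0 with hx | hx
    · have hzero : h x = 0 := by
        simp only [hdef]
        rw [← h₁, ← h₂, survival_lindleyStep_of_neg hx, survival_lindleyStep_of_neg hx, sub_self,
          abs_zero]
      rw [hzero]
      exact integral_nonneg fun u => abs_nonneg _
    · have hdiff : survival ν₁ x - survival ν₂ x
          = ∫ u, (survival ν₁ (x - u) - survival ν₂ (x - u)) ∂κ := by
        rw [integral_sub (integrable_survival_sub x) (integrable_survival_sub x), ← survival_conv,
          ← survival_conv, ← survival_lindleyStep_of_nonneg hx, h₁,
          ← survival_lindleyStep_of_nonneg hx, h₂]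
      exact (congrArg abs hdiff).trans_le abs_integral_le_integral_abs
  have hnonpos := nonpos_of_le_integral_sub hneg
    (measurable_survival.sub measurable_survival).abs (C := 1)
    (fun x => (abs_abs _).trans_le (abs_survival_sub_le_one x)) hlim hsub
  exact eq_of_survival (funext fun x => sub_eq_zero.1 (abs_nonpos_iff.1 (hnonpos x)))

end Lindley

section Exponential

variable {r μ η : ℝ}

lemma integral_expMeasure {E : Type*} [NormedAddCommGroup E] [NormedSpace ℝ E] (hr : 0 < r)
    (f : ℝ → E) :
    ∫ y, f y ∂(expMeasure r) = ∫ y in Set.Ioi 0, (r * Real.exp (-(r * y))) • f y := by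
  have hdensity : expMeasure r = volume.withDensity (exponentialPDF r) := rfl
  have hmeas : Measurable (exponentialPDF r) := (measurable_exponentialPDFReal r).ennreal_ofReal
  rw [hdensity, integral_withDensity_eq_integral_toReal_smul hmeas
    (Eventually.of_forall fun _ => ENNReal.ofReal_lt_top), ← integral_Ici_eq_integral_Ioi,
    ← integral_indicator measurableSet_Ici]
  congr 1 with y
  rw [exponentialPDF_eq, Set.indicator_apply]
  by_cases hy : 0 ≤ y
  · rw [if_pos hy, if_pos (Set.mem_Ici.2 hy), ENNReal.toReal_ofReal (by positivity)]
  · simp [hy]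

lemma integral_id_expMeasure (hr : 0 < r) : ∫ y, y ∂(expMeasure r) = 1 / r := by
  have hgamma : ∫ y in Set.Ioi (0 : ℝ), y * Real.exp (-(r * y)) = (1 / r) ^ 2 := by
    simpa only [show (2 : ℝ) - 1 = 1 by norm_num, Real.rpow_one, Real.rpow_two, Real.Gamma_two,
      mul_one] using Real.integral_rpow_mul_exp_neg_mul_Ioi (a := 2) two_pos hr
  simp only [integral_expMeasure hr, smul_eq_mul, mul_assoc, mul_comm (Real.exp _)]
  rw [integral_const_mul, hgamma]
  field_simp

lemma integrable_id_expMeasure (hr : 0 < r) : Integrable (fun y => y) (expMeasure r) :=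
  Integrable.of_integral_ne_zero (by rw [integral_id_expMeasure hr]; positivity)

lemma charFun_expMeasure (hr : 0 < r) (t : ℝ) :
    charFun (expMeasure r) t = r / (r - t * Complex.I) := by
  have hre : (t * Complex.I - r).re < 0 := by simpa using hr
  have hexp : ∀ y : ℝ, (r * Real.exp (-(r * y))) • Complex.exp (t * y * Complex.I)
      = r * Complex.exp ((t * Complex.I - r) * y) := fun y => by
    rw [Complex.real_smul, sub_mul, sub_eq_add_neg, Complex.exp_add]
    push_cast
    ring_nf
  rw [charFun_apply_real, integral_expMeasure hr]
  simp only [hexp]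
  rw [integral_const_mul, integral_exp_mul_complex_Ioi hre, Complex.ofReal_zero, mul_zero,
    Complex.exp_zero, ← neg_sub, div_neg, neg_div, neg_neg, mul_one_div]

lemma survival_expMeasure (hr : 0 < r) {x : ℝ} (hx : 0 ≤ x) :
    survival (expMeasure r) x = Real.exp (-(r * x)) := by
  have := isProbabilityMeasure_expMeasure hr
  rw [survival_eq_one_sub_cdf, cdf_expMeasure_eq hr, if_pos hx, sub_sub_cancel]

lemma survival_expMeasure_of_neg (hr : 0 < r) {x : ℝ} (hx : x < 0) :
    survival (expMeasure r) x = 1 := by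
  have := isProbabilityMeasure_expMeasure hr
  rw [survival_eq_one_sub_cdf, cdf_expMeasure_eq hr, if_neg hx.not_ge, sub_zero]

lemma ae_nonneg_expMeasure (hr : 0 < r) : ∀ᵐ y ∂(expMeasure r), 0 ≤ y := by
  have := isProbabilityMeasure_expMeasure hr
  have hIic : (expMeasure r).real (Set.Iic 0) = 0 := by
    rw [← cdf_eq_real, cdf_expMeasure_eq hr, if_pos le_rfl]
    simp
  rw [measureReal_eq_zero_iff] at hIic
  exact measure_mono_null (fun y (hy : ¬0 ≤ y) => (not_le.1 hy).le) hIic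

/-- The mixture of an atom at `0` of mass `1 - η` and an exponential law of rate `μ (1 - η)`: the
stationary law of the waiting time in a G/M/1 queue with service rate `μ`, for `η` the root of
`η = L_G (μ (1 - η))` in `[0, 1)`. -/
noncomputable def waitingLaw (μ η : ℝ) : Measure ℝ :=
  ENNReal.ofReal (1 - η) • Measure.dirac 0 + ENNReal.ofReal η • expMeasure (μ * (1 - η))

lemma isProbabilityMeasure_waitingLaw (hμ : 0 < μ) (h0 : 0 ≤ η) (h1 : η < 1) :
    IsProbabilityMeasure (waitingLaw μ η) := by
  have := isProbabilityMeasure_expMeasure (mul_pos hμ (sub_pos.2 h1))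
  refine ⟨?_⟩
  simp [waitingLaw, ← ENNReal.ofReal_add (sub_nonneg.2 h1.le) h0]

lemma integral_waitingLaw {E : Type*} [NormedAddCommGroup E] [NormedSpace ℝ E] [CompleteSpace E]
    (h0 : 0 ≤ η) (h1 : η ≤ 1) {f : ℝ → E} (hf : Integrable f (expMeasure (μ * (1 - η)))) :
    ∫ x, f x ∂(waitingLaw μ η) = (1 - η) • f 0 + η • ∫ x, f x ∂(expMeasure (μ * (1 - η))) := by
  rw [waitingLaw, integral_add_measure
    ((integrable_dirac enorm_lt_top).smul_measure ENNReal.ofReal_ne_top)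
    (hf.smul_measure ENNReal.ofReal_ne_top), integral_smul_measure, integral_smul_measure,
    integral_dirac, ENNReal.toReal_ofReal h0, ENNReal.toReal_ofReal (sub_nonneg.2 h1)]

lemma integrable_id_waitingLaw (hμ : 0 < μ) (h1 : η < 1) :
    Integrable (fun x => x) (waitingLaw μ η) :=
  ((integrable_dirac enorm_lt_top).smul_measure ENNReal.ofReal_ne_top).add_measure
    ((integrable_id_expMeasure (mul_pos hμ (sub_pos.2 h1))).smul_measure ENNReal.ofReal_ne_top)

lemma integral_id_waitingLaw (hμ : 0 < μ) (h0 : 0 ≤ η) (h1 : η < 1) :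
    ∫ x, x ∂(waitingLaw μ η) = η / (μ * (1 - η)) := by
  have hr := mul_pos hμ (sub_pos.2 h1)
  rw [integral_waitingLaw h0 h1.le (integrable_id_expMeasure hr), integral_id_expMeasure hr,
    smul_zero, zero_add, smul_eq_mul, mul_one_div]

lemma survival_waitingLaw_eq (hμ : 0 < μ) (h0 : 0 ≤ η) (h1 : η < 1) (x : ℝ) :
    survival (waitingLaw μ η) x
      = (1 - η) * (Set.Ioi x).indicator 1 0 + η * survival (expMeasure (μ * (1 - η))) x := by
  have := isProbabilityMeasure_expMeasure (mul_pos hμ (sub_pos.2 h1))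
  simp only [survival, ← integral_indicator_one (measurableSet_Ioi (a := x))]
  exact integral_waitingLaw h0 h1.le ((integrable_const 1).indicator measurableSet_Ioi)

lemma survival_waitingLaw (hμ : 0 < μ) (h0 : 0 ≤ η) (h1 : η < 1) {x : ℝ} (hx : 0 ≤ x) :
    survival (waitingLaw μ η) x = η * Real.exp (-(μ * (1 - η) * x)) := by
  rw [survival_waitingLaw_eq hμ h0 h1, survival_expMeasure (mul_pos hμ (sub_pos.2 h1)) hx,
    Set.indicator_of_notMem (Set.notMem_Ioi.2 hx), mul_zero, zero_add]

lemma survival_waitingLaw_of_neg (hμ : 0 < μ) (h0 : 0 ≤ η) (h1 : η < 1) {x : ℝ} (hx : x < 0) :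
    survival (waitingLaw μ η) x = 1 := by
  rw [survival_waitingLaw_eq hμ h0 h1, survival_expMeasure_of_neg (mul_pos hμ (sub_pos.2 h1)) hx,
    Set.indicator_of_mem (Set.mem_Ioi.2 hx), Pi.one_apply]
  ring

lemma charFun_waitingLaw (hμ : 0 < μ) (h0 : 0 ≤ η) (h1 : η < 1) (t : ℝ) :
    charFun (waitingLaw μ η) t = (1 - η) + η * charFun (expMeasure (μ * (1 - η))) t := by
  have := isProbabilityMeasure_expMeasure (mul_pos hμ (sub_pos.2 h1))
  simp only [charFun_apply_real]
  rw [integral_waitingLaw h0 h1.le]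
  · simp
  · refine Integrable.of_bound (by fun_prop) 1 (Eventually.of_forall fun x => ?_)
    rw [← Complex.ofReal_mul, Complex.norm_exp_ofReal_mul_I]

lemma waitingLaw_conv_expMeasure (hμ : 0 < μ) (h0 : 0 ≤ η) (h1 : η < 1) :
    waitingLaw μ η ∗ expMeasure μ = expMeasure (μ * (1 - η)) := by
  have hr := mul_pos hμ (sub_pos.2 h1)
  have := isProbabilityMeasure_expMeasure hr
  have := isProbabilityMeasure_expMeasure hμ
  have := isProbabilityMeasure_waitingLaw hμ h0 h1
  refine Measure.ext_of_charFun (funext fun t => ?_)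
  have hne : ∀ {s : ℝ}, 0 < s → (s : ℂ) - t * Complex.I ≠ 0 := fun hs h =>
    hs.ne' (by simpa using congrArg Complex.re h)
  have hne₁ := hne hμ
  have hne₂ := hne hr
  rw [charFun_conv, charFun_waitingLaw hμ h0 h1, charFun_expMeasure hμ, charFun_expMeasure hr,
    ← mul_div_assoc (η : ℂ), add_div' _ _ _ hne₂, div_mul_div_comm,
    div_eq_div_iff (mul_ne_zero hne₂ hne₁) hne₂]
  push_cast
  ring

end Exponential

section StationaryWaitingTime

variable {G : Measure ℝ} {μ η : ℝ}

/-- The law of a service time minus an independent inter-arrival time, in a G/M/1 queue with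
service rate `μ` and inter-arrival law `G`. -/
noncomputable def stepLaw (G : Measure ℝ) (μ : ℝ) : Measure ℝ := expMeasure μ ∗ G.map Neg.neg

lemma isProbabilityMeasure_stepLaw [IsProbabilityMeasure G] (hμ : 0 < μ) :
    IsProbabilityMeasure (stepLaw G μ) := by
  have := isProbabilityMeasure_expMeasure hμ
  have := Measure.isProbabilityMeasure_map (μ := G) measurable_neg.aemeasurable
  exact Measure.probabilitymeasure_of_probabilitymeasures_conv _ _

lemma integral_id_stepLaw_neg [IsProbabilityMeasure G] (hμ : 0 < μ) (hG : 1 / μ < ∫ x, x ∂G) :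
    ∫ u, u ∂(stepLaw G μ) < 0 := by
  have := isProbabilityMeasure_expMeasure hμ
  have := Measure.isProbabilityMeasure_map (μ := G) measurable_neg.aemeasurable
  have hGint : Integrable (fun x => x) G :=
    Integrable.of_integral_ne_zero ((one_div_pos.2 hμ).trans hG).ne'
  have hneg : Integrable (fun x => x) (G.map Neg.neg) :=
    (integrable_map_measure aestronglyMeasurable_id measurable_neg.aemeasurable).2 hGint.neg
  rw [stepLaw, Measure.conv, integral_map (by fun_prop) (by fun_prop),
    integral_add ((integrable_id_expMeasure hμ).comp_fst _) (hneg.comp_snd _),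
    integral_fun_fst (fun x => x), integral_fun_snd (fun x => x),
    integral_map measurable_neg.aemeasurable (by fun_prop), integral_neg,
    integral_id_expMeasure hμ]
  simpa using hG

lemma survival_waitingLaw_conv_stepLaw [IsProbabilityMeasure G] (hG : ∀ᵐ x ∂G, 0 ≤ x) (hμ : 0 < μ)
    (h0 : 0 ≤ η) (h1 : η < 1) {x : ℝ} (hx : 0 ≤ x) :
    survival (waitingLaw μ η ∗ stepLaw G μ) x
      = Real.exp (-(μ * (1 - η) * x)) * laplace G (μ * (1 - η)) := by
  have hr := mul_pos hμ (sub_pos.2 h1)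
  have := isProbabilityMeasure_expMeasure hμ
  have := isProbabilityMeasure_expMeasure hr
  have := Measure.isProbabilityMeasure_map (μ := G) measurable_neg.aemeasurable
  rw [stepLaw, ← Measure.conv_assoc, waitingLaw_conv_expMeasure hμ h0 h1, survival_conv,
    integral_map measurable_neg.aemeasurable (integrable_survival_sub x).aestronglyMeasurable,
    laplace, ← integral_const_mul]
  refine integral_congr_ae ?_
  filter_upwards [hG] with a ha
  rw [sub_neg_eq_add, survival_expMeasure hr (by positivity), ← Real.exp_add]
  ring_nf

lemma lindleyStep_waitingLaw [IsProbabilityMeasure G] (hG : ∀ᵐ x ∂G, 0 ≤ x) (hμ : 0 < μ)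
    (h0 : 0 ≤ η) (h1 : η < 1) (hη : η ∈ rootSet G μ) :
    lindleyStep (stepLaw G μ) (waitingLaw μ η) = waitingLaw μ η := by
  have := isProbabilityMeasure_stepLaw (G := G) hμ
  have := isProbabilityMeasure_waitingLaw hμ h0 h1
  have : IsProbabilityMeasure (lindleyStep (stepLaw G μ) (waitingLaw μ η)) :=
    Measure.isProbabilityMeasure_map (by fun_prop)
  refine eq_of_survival (funext fun x => ?_)
  rcases lt_or_ge x 0 with hx | hx
  · rw [survival_lindleyStep_of_neg hx, survival_waitingLaw_of_neg hμ h0 h1 hx]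
  · rw [survival_lindleyStep_of_nonneg hx, survival_waitingLaw_conv_stepLaw hG hμ h0 h1 hx, ← hη,
      survival_waitingLaw hμ h0 h1 hx, mul_comm]

end StationaryWaitingTime

section Roots

variable {G : Measure ℝ} [IsProbabilityMeasure G] {lam μ η x : ℝ}

lemma integrable_exp_neg_mul (hG : ∀ᵐ x ∂G, 0 ≤ x) {s : ℝ} (hs : 0 ≤ s) :
    Integrable (fun x => Real.exp (-(s * x))) G := by
  refine Integrable.of_bound (by fun_prop) 1 ?_
  filter_upwards [hG] with x hx
  rw [Real.norm_eq_abs, Real.abs_exp, Real.exp_le_one_iff, neg_nonpos]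
  positivity

lemma laplace_pos (hG : ∀ᵐ x ∂G, 0 ≤ x) {s : ℝ} (hs : 0 ≤ s) : 0 < laplace G s :=
  integral_exp_pos (integrable_exp_neg_mul hG hs)

lemma continuousOn_laplace (hG : ∀ᵐ x ∂G, 0 ≤ x) : ContinuousOn (laplace G) (Set.Ici 0) := by
  refine continuousOn_of_dominated (bound := fun _ => 1) (fun s _ => by fun_prop)
    (fun s hs => ?_) (integrable_const 1) (Eventually.of_forall fun x => by fun_prop)
  filter_upwards [hG] with x hx
  rw [Real.norm_eq_abs, Real.abs_exp, Real.exp_le_one_iff, neg_nonpos]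
  exact mul_nonneg hs hx

lemma pos_of_mem_rootSet (hG : ∀ᵐ x ∂G, 0 ≤ x) (hμ : 0 < μ) (hx : x ∈ rootSet G μ) : 0 < x := by
  by_contra! hx0
  exact hx0.not_gt (hx.symm ▸ laplace_pos hG (mul_nonneg hμ.le (by linarith)))

lemma exists_mem_rootSet_le (hG : ∀ᵐ x ∂G, 0 ≤ x) (hμ : 0 < μ) {c : ℝ} (h0 : 0 ≤ c)
    (h1 : c ≤ 1) (hc : laplace G (μ * (1 - c)) ≤ c) : ∃ η ∈ rootSet G μ, η ≤ c := by
  have hcont : ContinuousOn (fun x => x - laplace G (μ * (1 - x))) (Set.Icc 0 c) :=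
    continuousOn_id.sub ((continuousOn_laplace hG).comp (by fun_prop) fun x hx =>
      mul_nonneg hμ.le (by linarith [hx.2]))
  have hpos : 0 < laplace G (μ * (1 - 0)) := laplace_pos hG (by linarith)
  obtain ⟨η, hη, hzero⟩ := intermediate_value_Icc h0 hcont
    (show (0 : ℝ) ∈ Set.Icc _ _ from ⟨by linarith, by linarith⟩)
  exact ⟨η, sub_eq_zero.1 hzero, hη.2⟩

lemma one_sub_exp_neg_div_mem_Icc {s x : ℝ} (hs : 0 < s) (hx : 0 ≤ x) :
    (1 - Real.exp (-(s * x))) / s ∈ Set.Icc 0 x := by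
  have hle : Real.exp (-(s * x)) ≤ 1 := Real.exp_le_one_iff.2 (neg_nonpos.2 (by positivity))
  have hge := Real.add_one_le_exp (-(s * x))
  exact ⟨div_nonneg (by linarith) hs.le, (div_le_iff₀ hs).2 (by linarith)⟩

lemma tendsto_one_sub_exp_neg_div (x : ℝ) :
    Tendsto (fun s => (1 - Real.exp (-(s * x))) / s) (𝓝[>] 0) (𝓝 x) := by
  have hderiv : HasDerivAt (fun s : ℝ => 1 - Real.exp (-(s * x))) x 0 := by
    simpa using (((hasDerivAt_id (0 : ℝ)).mul_const x).neg.exp).const_sub 1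
  refine ((hasDerivAt_iff_tendsto_slope_zero.1 hderiv).mono_left
    (nhdsGT_le_nhdsNE 0)).congr fun s => ?_
  simp [div_eq_inv_mul]

lemma tendsto_one_sub_laplace_div (hG : ∀ᵐ x ∂G, 0 ≤ x) (hint : Integrable (fun x => x) G) :
    Tendsto (fun s => (1 - laplace G s) / s) (𝓝[>] 0) (𝓝 (∫ x, x ∂G)) := by
  have hto : Tendsto (fun s => ∫ x, (1 - Real.exp (-(s * x))) / s ∂G) (𝓝[>] 0)
      (𝓝 (∫ x, x ∂G)) := by
    refine tendsto_integral_filter_of_dominated_convergence (fun x => x)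
      (Eventually.of_forall fun s => by fun_prop) ?_ hint
      (Eventually.of_forall tendsto_one_sub_exp_neg_div)
    filter_upwards [self_mem_nhdsWithin] with s hs
    filter_upwards [hG] with x hx
    have hmem := one_sub_exp_neg_div_mem_Icc hs hx
    exact (Real.norm_of_nonneg hmem.1).trans_le hmem.2
  refine hto.congr' ?_
  filter_upwards [self_mem_nhdsWithin] with s hs
  rw [integral_div, integral_sub (integrable_const 1) (integrable_exp_neg_mul hG (le_of_lt hs))]
  simp [laplace]

lemma exists_mem_rootSet_lt_one (hG : ∀ᵐ x ∂G, 0 ≤ x) (hμ : 0 < μ) (hmean : 1 / μ < ∫ x, x ∂G) :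
    ∃ η ∈ rootSet G μ, η < 1 := by
  have hint : Integrable (fun x => x) G :=
    Integrable.of_integral_ne_zero ((one_div_pos.2 hμ).trans hmean).ne'
  obtain ⟨s, ⟨hs, hsμ⟩, hs0 : 0 < s⟩ :=
    (((tendsto_one_sub_laplace_div hG hint).eventually (lt_mem_nhds hmean)).and
      (nhdsWithin_le_nhds (gt_mem_nhds hμ))).and self_mem_nhdsWithin |>.exists
  have hpos : 0 < s / μ := by positivity
  obtain ⟨η, hη, hle⟩ := exists_mem_rootSet_le hG hμ (c := 1 - s / μ)
    (sub_nonneg.2 ((div_le_one hμ).2 hsμ.le)) (by linarith) (by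
      rw [lt_div_iff₀ hs0, one_div_mul_eq_div] at hs
      rw [sub_sub_cancel, mul_div_cancel₀ _ hμ.ne']
      linarith)
  exact ⟨η, hη, by linarith⟩

lemma eq_of_mem_rootSet (hG : ∀ᵐ x ∂G, 0 ≤ x) (hμ : 0 < μ) (hmean : 1 / μ < ∫ x, x ∂G)
    (hη : η ∈ rootSet G μ) (hη1 : η < 1) (hx : x ∈ rootSet G μ) (hx1 : x < 1) : η = x := by
  have hη0 := (pos_of_mem_rootSet hG hμ hη).le
  have hx0 := (pos_of_mem_rootSet hG hμ hx).le
  have := isProbabilityMeasure_stepLaw (G := G) hμ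
  have := isProbabilityMeasure_waitingLaw hμ hη0 hη1
  have := isProbabilityMeasure_waitingLaw hμ hx0 hx1
  have heq : waitingLaw μ η = waitingLaw μ x :=
    eq_of_lindleyStep_eq (integral_id_stepLaw_neg hμ hmean)
      (lindleyStep_waitingLaw hG hμ hη0 hη1 hη) (lindleyStep_waitingLaw hG hμ hx0 hx1 hx)
  have hsurvival : survival (waitingLaw μ η) 0 = survival (waitingLaw μ x) 0 := by rw [heq]
  simpa [survival_waitingLaw hμ hη0 hη1, survival_waitingLaw hμ hx0 hx1] using hsurvival

lemma smallestRoot_eq (hG : ∀ᵐ x ∂G, 0 ≤ x) (hμ : 0 < μ) (hmean : 1 / μ < ∫ x, x ∂G)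
    (hη : η ∈ rootSet G μ) (hη1 : η < 1) : smallestRoot G μ = η := by
  refine IsLeast.csInf_eq ⟨hη, fun x hx => ?_⟩
  by_contra! hlt
  exact hlt.ne' (eq_of_mem_rootSet hG hμ hmean hη hη1 hx (hlt.trans hη1))

lemma smallestRoot_mem_rootSet (hG : ∀ᵐ x ∂G, 0 ≤ x) (hμ : 0 < μ) (hmean : 1 / μ < ∫ x, x ∂G) :
    smallestRoot G μ ∈ rootSet G μ := by
  obtain ⟨η, hη, hη1⟩ := exists_mem_rootSet_lt_one hG hμ hmean
  rwa [smallestRoot_eq hG hμ hmean hη hη1]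

lemma smallestRoot_lt_one (hG : ∀ᵐ x ∂G, 0 ≤ x) (hμ : 0 < μ) (hmean : 1 / μ < ∫ x, x ∂G) :
    smallestRoot G μ < 1 := by
  obtain ⟨η, hη, hη1⟩ := exists_mem_rootSet_lt_one hG hμ hmean
  rwa [smallestRoot_eq hG hμ hmean hη hη1]

lemma isLeast_smallestRoot (hG : ∀ᵐ x ∂G, 0 ≤ x) (hμ : 0 < μ) (hmean : 1 / μ < ∫ x, x ∂G) :
    IsLeast (rootSet G μ) (smallestRoot G μ) :=
  ⟨smallestRoot_mem_rootSet hG hμ hmean, fun _ hx =>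
    csInf_le ⟨0, fun _ hy => (pos_of_mem_rootSet hG hμ hy).le⟩ hx⟩

lemma smallestRoot_pos (hG : ∀ᵐ x ∂G, 0 ≤ x) (hμ : 0 < μ) (hmean : 1 / μ < ∫ x, x ∂G) :
    0 < smallestRoot G μ :=
  pos_of_mem_rootSet hG hμ (smallestRoot_mem_rootSet hG hμ hmean)

end Roots

section Lambert

variable {lam μ η : ℝ}

lemma lambertW_mul_exp {v : ℝ} (hv : -1 ≤ v) : lambertW (v * Real.exp v) = v := by
  have hmono : StrictMonoOn (fun w : ℝ => w * Real.exp w) (Set.Ici (-1)) := by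
    refine strictMonoOn_of_deriv_pos (convex_Ici _) (by fun_prop) fun w hw => ?_
    have hderiv : HasDerivAt (fun w : ℝ => w * Real.exp w) (1 * Real.exp w + w * Real.exp w) w :=
      (hasDerivAt_id w).mul (Real.hasDerivAt_exp w)
    rw [interior_Ici] at hw
    rw [hderiv.deriv, ← add_mul]
    exact mul_pos (by linarith [Set.mem_Ioi.1 hw]) (Real.exp_pos w)
  exact hmono.injOn.leftInvOn_invFunOn (Set.mem_Ici.2 hv)

lemma laplace_dirac (c s : ℝ) : laplace (Measure.dirac c) s = Real.exp (-(s * c)) := by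
  rw [laplace, integral_dirac]

lemma ae_nonneg_dirac {c : ℝ} (hc : 0 ≤ c) : ∀ᵐ x ∂(Measure.dirac c), 0 ≤ x := by
  simpa [ae_dirac_eq] using hc

lemma one_div_lt_integral_dirac (hlam : 0 < lam) (hlt : lam < μ) :
    1 / μ < ∫ x, x ∂(Measure.dirac (1 / lam)) := by
  rw [integral_dirac]
  exact one_div_lt_one_div_of_lt hlam hlt

lemma exists_mem_rootSet_dirac_le (hlam : 0 < lam) (hlt : lam < μ) :
    ∃ η ∈ rootSet (Measure.dirac (1 / lam)) μ, η ≤ lam / μ := by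
  have hμ : 0 < μ := hlam.trans hlt
  have hρ : 0 < lam / μ := by positivity
  refine exists_mem_rootSet_le (ae_nonneg_dirac (one_div_pos.2 hlam).le) hμ hρ.le
    ((div_le_one hμ).2 hlt.le) ?_
  have hexponent : -(μ * (1 - lam / μ) * (1 / lam)) = 1 - (lam / μ)⁻¹ := by
    field_simp
    ring
  rw [laplace_dirac, ← Real.le_log_iff_exp_le hρ, hexponent]
  exact Real.one_sub_inv_le_log_of_pos hρ

lemma eq_lambertW_of_mem_rootSet_dirac (hlam : 0 < lam) (hμ : 0 < μ) (hle : η ≤ lam / μ)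
    (hη : η ∈ rootSet (Measure.dirac (1 / lam)) μ) :
    η = -(lam / μ) * lambertW (-(1 / (lam / μ)) * Real.exp (-(1 / (lam / μ)))) := by
  have hρ : 0 < lam / μ := by positivity
  have hroot : η = Real.exp (-(μ * (1 - η) * (1 / lam))) := by
    rw [← laplace_dirac]
    exact hη
  have hexp : Real.exp (-(1 / (lam / μ))) = η * Real.exp (-(η / (lam / μ))) := by
    nth_rewrite 1 [hroot]
    rw [← Real.exp_add]
    congr 1
    field_simp
    ring
  have harg : -(1 / (lam / μ)) * Real.exp (-(1 / (lam / μ)))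
      = -(η / (lam / μ)) * Real.exp (-(η / (lam / μ))) := by
    rw [hexp]
    ring
  rw [harg, lambertW_mul_exp (neg_le_neg ((div_le_one hρ).2 hle))]
  field_simp

lemma smallestRoot_dirac (hlam : 0 < lam) (hlt : lam < μ) :
    smallestRoot (Measure.dirac (1 / lam)) μ
      = -(lam / μ) * lambertW (-(1 / (lam / μ)) * Real.exp (-(1 / (lam / μ)))) := by
  have hμ : 0 < μ := hlam.trans hlt
  obtain ⟨η, hη, hle⟩ := exists_mem_rootSet_dirac_le hlam hlt
  rw [← eq_lambertW_of_mem_rootSet_dirac hlam hμ hle hη]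
  exact smallestRoot_eq (ae_nonneg_dirac (one_div_pos.2 hlam).le) hμ
    (one_div_lt_integral_dirac hlam hlt) hη (hle.trans_lt ((div_lt_one hμ).2 hlt))

end Lambert

namespace IsSteadyGM1

variable {Ω : Type*} [MeasurableSpace Ω] {P : Measure Ω} {G : Measure ℝ} {μ : ℝ}
  {A H W : ℕ → Ω → ℝ}

lemma waiting_nonneg (h : IsSteadyGM1 P G μ A H W) (n : ℕ) (ω : Ω) : 0 ≤ W n ω := by
  cases n with
  | zero => exact h.initial_nonneg ω
  | succ n => exact (h.lindley n ω).symm ▸ le_max_left _ _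

lemma hasLaw_arrival (h : IsSteadyGM1 P G μ A H W) (n : ℕ) : HasLaw (A n) G P :=
  ⟨(h.measurable_A n).aemeasurable, h.law_A n⟩

lemma hasLaw_service (h : IsSteadyGM1 P G μ A H W) (n : ℕ) : HasLaw (H n) (expMeasure μ) P :=
  ⟨(h.measurable_H n).aemeasurable, h.law_H n⟩

lemma ae_nonneg_sojourn (h : IsSteadyGM1 P G μ A H W) (hμ : 0 < μ) :
    ∀ᵐ ω ∂P, ∀ n, 0 ≤ sojourn W H n ω := by
  refine ae_all_iff.2 fun n => ?_
  filter_upwards [((h.hasLaw_service n).ae_iff (by fun_prop)).2 (ae_nonneg_expMeasure hμ)] with ω hω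
  exact add_nonneg (h.waiting_nonneg n ω) hω

lemma integrable_service (h : IsSteadyGM1 P G μ A H W) (hμ : 0 < μ) (n : ℕ) :
    Integrable (H n) P := by
  have hint := integrable_id_expMeasure hμ
  rw [← h.law_H n] at hint
  exact hint.comp_measurable (h.measurable_H n)

lemma indepFun_waiting_service_sub_arrival (h : IsSteadyGM1 P G μ A H W) :
    IndepFun (W 0) (fun ω => H 0 ω - A 0 ω) P :=
  h.indep_initial.comp (φ := id) (ψ := fun p : ℕ → ℝ × ℝ => (p 0).2 - (p 0).1) measurable_id
    (by fun_prop)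

variable [IsProbabilityMeasure G]

lemma hasLaw_service_sub_arrival (h : IsSteadyGM1 P G μ A H W) (hμ : 0 < μ) (n : ℕ) :
    HasLaw (fun ω => H n ω - A n ω) (stepLaw G μ) P := by
  have := isProbabilityMeasure_expMeasure hμ
  have hneg : HasLaw Neg.neg (G.map Neg.neg) G := ⟨measurable_neg.aemeasurable, rfl⟩
  simpa only [sub_eq_add_neg, stepLaw] using IndepFun.hasLaw_fun_add (h.hasLaw_service n)
    (hneg.fun_comp (h.hasLaw_arrival n)) ((h.indep_A_H n).symm.comp measurable_id measurable_neg)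

variable [IsProbabilityMeasure P]

lemma lindleyStep_map_waiting (h : IsSteadyGM1 P G μ A H W) (hμ : 0 < μ) :
    lindleyStep (stepLaw G μ) (P.map (W 0)) = P.map (W 0) := by
  have := isProbabilityMeasure_stepLaw (G := G) hμ
  have hsum := IndepFun.hasLaw_fun_add ⟨(h.measurable_W 0).aemeasurable, rfl⟩
    (h.hasLaw_service_sub_arrival hμ 0) h.indepFun_waiting_service_sub_arrival
  have hmax : HasLaw (fun y : ℝ => max 0 y) (lindleyStep (stepLaw G μ) (P.map (W 0)))
      (P.map (W 0) ∗ stepLaw G μ) := ⟨by fun_prop, rfl⟩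
  have hnext : (fun ω => max 0 (W 0 ω + (H 0 ω - A 0 ω))) = W 1 := by
    ext ω
    rw [h.lindley, add_sub_assoc]
  rw [← (hmax.fun_comp hsum).map_eq, hnext, h.steady]

variable (hG : ∀ᵐ x ∂G, 0 ≤ x) (hμ : 0 < μ) (hmean : 1 / μ < ∫ x, x ∂G)

include hG hμ hmean

lemma hasLaw_waiting (h : IsSteadyGM1 P G μ A H W) (n : ℕ) :
    HasLaw (W n) (waitingLaw μ (smallestRoot G μ)) P := by
  have h0 := (smallestRoot_pos hG hμ hmean).le
  have h1 := smallestRoot_lt_one hG hμ hmean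
  have := isProbabilityMeasure_stepLaw (G := G) hμ
  have := isProbabilityMeasure_waitingLaw hμ h0 h1
  have := Measure.isProbabilityMeasure_map (μ := P) (h.measurable_W 0).aemeasurable
  refine ⟨(h.measurable_W n).aemeasurable, (h.steady n).trans ?_⟩
  exact eq_of_lindleyStep_eq (integral_id_stepLaw_neg hμ hmean) (h.lindleyStep_map_waiting hμ)
    (lindleyStep_waitingLaw hG hμ h0 h1 (smallestRoot_mem_rootSet hG hμ hmean))

lemma integrable_waiting (h : IsSteadyGM1 P G μ A H W) (n : ℕ) : Integrable (W n) P := by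
  have hint := integrable_id_waitingLaw hμ (smallestRoot_lt_one hG hμ hmean)
  rw [← (h.hasLaw_waiting hG hμ hmean n).map_eq] at hint
  exact hint.comp_measurable (h.measurable_W n)

lemma integrable_sojourn (h : IsSteadyGM1 P G μ A H W) (n : ℕ) :
    Integrable (sojourn W H n) P :=
  (h.integrable_waiting hG hμ hmean n).add (h.integrable_service hμ n)

lemma integral_sojourn (h : IsSteadyGM1 P G μ A H W) (n : ℕ) :
    ∫ ω, sojourn W H n ω ∂P = 1 / μ + smallestRoot G μ / (μ * (1 - smallestRoot G μ)) := by
  simp only [sojourn]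
  rw [integral_add (h.integrable_waiting hG hμ hmean n) (h.integrable_service hμ n),
    (h.hasLaw_waiting hG hμ hmean n).integral_eq, (h.hasLaw_service n).integral_eq,
    integral_id_waitingLaw hμ (smallestRoot_pos hG hμ hmean).le (smallestRoot_lt_one hG hμ hmean),
    integral_id_expMeasure hμ, add_comm]

end IsSteadyGM1

namespace IsSteadyDM1

variable {Ω : Type*} [MeasurableSpace Ω] {P : Measure Ω} [IsProbabilityMeasure P] {lam μ : ℝ}
  {H W : ℕ → Ω → ℝ}

lemma integrable_sojourn (h : IsSteadyDM1 P lam μ H W) (hlam : 0 < lam) (hlt : lam < μ) (n : ℕ) :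
    Integrable (sojourn W H n) P :=
  IsSteadyGM1.integrable_sojourn (ae_nonneg_dirac (one_div_pos.2 hlam).le) (hlam.trans hlt)
    (one_div_lt_integral_dirac hlam hlt) h n

lemma integral_sojourn (h : IsSteadyDM1 P lam μ H W) (hlam : 0 < lam) (hlt : lam < μ) (n : ℕ) :
    ∫ ω, sojourn W H n ω ∂P = 1 / μ + (1 / μ) *
      ((-(lam / μ) * lambertW (-(1 / (lam / μ)) * Real.exp (-(1 / (lam / μ)))))
        / (1 + (lam / μ) * lambertW (-(1 / (lam / μ)) * Real.exp (-(1 / (lam / μ)))))) := by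
  rw [IsSteadyGM1.integral_sojourn (ae_nonneg_dirac (one_div_pos.2 hlam).le) (hlam.trans hlt)
    (one_div_lt_integral_dirac hlam hlt) h n, smallestRoot_dirac hlam hlt, div_mul_div_comm,
    one_mul, neg_mul, sub_neg_eq_add]

end IsSteadyDM1

section AverageAoI

lemma eq_sum_indicator {Ω ι : Type*} [Fintype ι] (C : Ω → ι) (D : ι → Ω → ℝ) :
    (fun ω => D (C ω) ω) = fun ω => ∑ i, {ω | C ω = i}.indicator (D i) ω := by
  classical
  ext ω
  simp [Set.indicator_apply]

lemma integrable_select {Ω ι : Type*} [MeasurableSpace Ω] {P : Measure Ω} [Finite ι]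
    [MeasurableSpace ι] [MeasurableSingletonClass ι] {C : Ω → ι} (hC : Measurable C)
    {D : ι → Ω → ℝ} (hD : ∀ i, Integrable (D i) P) : Integrable (fun ω => D (C ω) ω) P := by
  have := Fintype.ofFinite ι
  rw [eq_sum_indicator]
  exact integrable_finsetSum _ fun i _ => (hD i).indicator (hC (measurableSet_singleton i))

variable {Ω : Type*} [MeasurableSpace Ω] {P : Measure Ω} {ι : Type*} [Fintype ι]
  [MeasurableSpace ι] [MeasurableSingletonClass ι]

lemma measurable_category (ξhat : ℝ) : Measurable (category ξhat) :=
  Measurable.ite measurableSet_Ici measurable_const measurable_const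

lemma sum_measureReal_eq [IsProbabilityMeasure P] {C : Ω → ι} (hC : Measurable C) :
    ∑ i, P.real {ω | C ω = i} = 1 := by
  have hsum := sum_measureReal_preimage_singleton (μ := P) (Finset.univ : Finset ι)
    fun i _ => hC (measurableSet_singleton i)
  rwa [Finset.coe_univ, Set.preimage_univ, probReal_univ] at hsum

lemma integral_select {C : Ω → ι} (hC : Measurable C) {D : ι → Ω → ℝ}
    (hD : ∀ i, Integrable (D i) P) (hind : ∀ i, IndepFun C (D i) P) :
    ∫ ω, D (C ω) ω ∂P = ∑ i, P.real {ω | C ω = i} * ∫ ω, D i ω ∂P := by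
  classical
  have hset : ∀ i, MeasurableSet {ω | C ω = i} := fun i => hC (measurableSet_singleton i)
  rw [eq_sum_indicator, integral_finsetSum _ fun i _ => (hD i).indicator (hset i)]
  refine Finset.sum_congr rfl fun i _ => ?_
  have hmul := (hind i).integral_fun_comp_mul_comp (f := Set.indicator {i} 1) (g := id)
    hC.aemeasurable (hD i).aemeasurable
    (measurable_one.indicator (measurableSet_singleton i)).aestronglyMeasurable (by fun_prop)
  have hone : (fun ω => ({i} : Set ι).indicator (1 : ι → ℝ) (C ω)) = {ω | C ω = i}.indicator 1 := by
    ext ω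
    simp [Set.indicator_apply]
  simp only [id_eq, hone] at hmul
  rw [integral_indicator_one (hset i)] at hmul
  rw [← hmul]
  congr 1 with ω
  simp [Set.indicator_apply]

lemma averageAoI_eq [IsProbabilityMeasure P] {lam : ℝ} {D : ℕ → Ω → ℝ} {n : ℕ} (hlam : 0 < lam)
    (hD : Integrable (D (n + 1)) P) :
    averageAoI P lam D n = 1 / (2 * lam) + ∫ ω, D (n + 1) ω ∂P := by
  simp only [averageAoI, meanArea, polygonArea_eq, genInterval_eq]
  rw [integral_add (integrable_const _) (hD.const_mul _), integral_const_mul]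
  simp only [integral_const, probReal_univ, one_smul]
  field_simp

lemma ae_tendsto_timeAverageAge [IsProbabilityMeasure P] {lam : ℝ} {D : ℕ → Ω → ℝ} (hlam : 0 < lam)
    (hD : ∀ᵐ ω ∂P, ∀ n, 0 ≤ D n ω) (hord : DeparturesOrdered P lam D)
    (herg : AreasErgodic P lam D) :
    ∀ᵐ ω ∂P, Tendsto (timeAverageAge lam fun n => D n ω) atTop (𝓝 (averageAoI P lam D 0)) := by
  have hlimit : averageAoI P lam D 0 = meanArea P lam D 0 * lam := by
    simp [averageAoI, genInterval_eq]
  filter_upwards [hD, hord, herg] with ω hnonneg hmono hq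
  exact hlimit ▸ tendsto_timeAverageAge hlam hnonneg hmono hq

variable {lam : ℝ} {Φ S D₀ Dserv : ℕ → Ω → ℝ} {n : ℕ}

lemma integrable_systemDelay (hT : Integrable (fun ω => Φ n ω / S n ω) P)
    (h₀ : Integrable (D₀ n) P) (hserv : Integrable (Dserv n) P) :
    Integrable (systemDelay Φ S D₀ Dserv n) P :=
  (hT.add h₀).add hserv

lemma ae_nonneg_systemDelay (hΦ : ∀ n ω, 0 ≤ Φ n ω) (hS : ∀ n ω, 0 < S n ω)
    (h₀ : ∀ᵐ ω ∂P, ∀ n, 0 ≤ D₀ n ω) (hserv : ∀ᵐ ω ∂P, ∀ n, 0 ≤ Dserv n ω) :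
    ∀ᵐ ω ∂P, ∀ n, 0 ≤ systemDelay Φ S D₀ Dserv n ω := by
  filter_upwards [h₀, hserv] with ω hω₀ hωserv n
  exact add_nonneg (add_nonneg (div_nonneg (hΦ n ω) (hS n ω).le) (hω₀ n)) (hωserv n)

lemma averageAoI_systemDelay [IsProbabilityMeasure P] (hlam : 0 < lam)
    (hT : Integrable (fun ω => Φ (n + 1) ω / S (n + 1) ω) P) (h₀ : Integrable (D₀ (n + 1)) P)
    (hserv : Integrable (Dserv (n + 1)) P) :
    averageAoI P lam (systemDelay Φ S D₀ Dserv) n = 1 / (2 * lam)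
      + ∫ ω, Φ (n + 1) ω / S (n + 1) ω ∂P + ∫ ω, D₀ (n + 1) ω ∂P + ∫ ω, Dserv (n + 1) ω ∂P := by
  rw [averageAoI_eq hlam (integrable_systemDelay hT h₀ hserv)]
  simp only [systemDelay]
  rw [integral_add (f := fun ω => Φ (n + 1) ω / S (n + 1) ω + D₀ (n + 1) ω) (hT.add h₀) hserv,
    integral_add hT h₀]
  ring

lemma averageAoI_systemDelay_select [IsProbabilityMeasure P] {C : ℕ → Ω → ι}
    {Ds : ι → ℕ → Ω → ℝ} (hlam : 0 < lam) (hC : Measurable (C (n + 1)))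
    (hind : ∀ i, IndepFun (C (n + 1)) (Ds i (n + 1)) P)
    (hT : Integrable (fun ω => Φ (n + 1) ω / S (n + 1) ω) P) (h₀ : Integrable (D₀ (n + 1)) P)
    (hDs : ∀ i, Integrable (Ds i (n + 1)) P) :
    averageAoI P lam (systemDelay Φ S D₀ fun n ω => Ds (C n ω) n ω) n
      = ∑ i, P.real {ω | C (n + 1) ω = i} * averageAoI P lam (systemDelay Φ S D₀ (Ds i)) n := by
  simp only [fun i => averageAoI_systemDelay hlam hT h₀ (hDs i)]
  rw [averageAoI_systemDelay hlam hT h₀ (integrable_select hC hDs), integral_select hC hDs hind]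
  simp only [mul_add, Finset.sum_add_distrib, ← Finset.sum_mul, sum_measureReal_eq hC, one_mul]

lemma averageAoI_systemDelay_category [IsProbabilityMeasure P] {ξ : ℕ → Ω → ℝ} {ξhat a b : ℝ}
    {Ds : Fin 2 → ℕ → Ω → ℝ} (hlam : 0 < lam) (hξ : Measurable (ξ (n + 1))) (hab : a + b = 1)
    (ha : P.real {ω | category ξhat (ξ (n + 1) ω) = 0} = a)
    (hind : ∀ i, IndepFun (fun ω => category ξhat (ξ (n + 1) ω)) (Ds i (n + 1)) P)
    (hT : Integrable (fun ω => Φ (n + 1) ω / S (n + 1) ω) P) (h₀ : Integrable (D₀ (n + 1)) P)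
    (hDs : ∀ i, Integrable (Ds i (n + 1)) P) :
    averageAoI P lam (systemDelay Φ S D₀ fun n ω => Ds (category ξhat (ξ n ω)) n ω) n
      = a * averageAoI P lam (systemDelay Φ S D₀ (Ds 0)) n
        + b * averageAoI P lam (systemDelay Φ S D₀ (Ds 1)) n := by
  have hC : Measurable fun ω => category ξhat (ξ (n + 1) ω) := (measurable_category ξhat).comp hξ
  have hb : P.real {ω | category ξhat (ξ (n + 1) ω) = 1} = b := by
    have hsum := sum_measureReal_eq (P := P) hC
    rw [Fin.sum_univ_two, ha] at hsum
    linarith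
  rw [averageAoI_systemDelay_select (C := fun n ω => category ξhat (ξ n ω)) hlam hC hind hT h₀ hDs,
    Fin.sum_univ_two, ha, hb]

end AverageAoI

end AoI

theorem mainTheorem1
    {Ω : Type*} [MeasurableSpace Ω] (P : Measure Ω) [IsProbabilityMeasure P]
    -- rates of the scheduler (a D/M/1 queue)
    (lam₀ μ₀ : ℝ) (hlam₀ : 0 < lam₀) (hρ₀ : lam₀ < μ₀)
    -- inter-arrival laws and rates of the two servers (G/M/1 queues)
    (G : Fin 2 → Measure ℝ) [∀ i, IsProbabilityMeasure (G i)]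
    (hG : ∀ i, ∀ᵐ x ∂(G i), 0 ≤ x)
    (lam μ : Fin 2 → ℝ) (hlam : ∀ i, 0 < lam i)
    (hmean : ∀ i, ∫ x, x ∂(G i) = 1 / lam i) (hρ : ∀ i, lam i < μ i)
    -- the three queues, in steady state
    (H₀ W₀ : ℕ → Ω → ℝ) (hsched : AoI.IsSteadyDM1 P lam₀ μ₀ H₀ W₀)
    (A H W : Fin 2 → ℕ → Ω → ℝ)
    (hserv : ∀ i, AoI.IsSteadyGM1 P (G i) (μ i) (A i) (H i) (W i))
    -- packet volumes and semantic rates, with constant mean transmission time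
    (Φ S : ℕ → Ω → ℝ) (hΦm : ∀ n, Measurable (Φ n)) (hSm : ∀ n, Measurable (S n))
    (hΦ : ∀ n ω, 0 ≤ Φ n ω) (hS : ∀ n ω, 0 < S n ω)
    (hT : ∀ n, Integrable (fun ω => Φ n ω / S n ω) P)
    (hTconst : ∀ n, ∫ ω, Φ n ω / S n ω ∂P = ∫ ω, Φ 0 ω / S 0 ω ∂P)
    -- semantic similarities and the proportions of the two categories
    (ξ : ℕ → Ω → ℝ) (ξhat : ℝ) (hξm : ∀ n, Measurable (ξ n))
    (a b : ℝ) (hab : a + b = 1)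
    (ha : ∀ n, P.real {ω | AoI.category ξhat (ξ n ω) = 0} = a)
    (hcat : ∀ i n, IndepFun (fun ω => AoI.category ξhat (ξ n ω))
      (AoI.sojourn (W i) (H i) n) P) :
    let ρ₀ : ℝ := lam₀ / μ₀
    let w : ℝ := AoI.lambertW (-(1 / ρ₀) * Real.exp (-(1 / ρ₀)))
    let η : Fin 2 → ℝ := fun i => AoI.smallestRoot (G i) (μ i)
    let D₀ : ℕ → Ω → ℝ := AoI.sojourn W₀ H₀
    let Ds : Fin 2 → ℕ → Ω → ℝ := fun i => AoI.sojourn (W i) (H i)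
    -- system delay of the updates on the path through server `i`
    let Dpath : Fin 2 → ℕ → Ω → ℝ := fun i => AoI.systemDelay Φ S D₀ (Ds i)
    -- system delay over all updates, each one being served according to its category
    let Dall : ℕ → Ω → ℝ :=
      AoI.systemDelay Φ S D₀ (fun n ω => Ds (AoI.category ξhat (ξ n ω)) n ω)
    let Δ : Fin 2 → ℝ := fun i =>
      1 / (2 * lam₀) + ∫ ω, Φ 0 ω / S 0 ω ∂P + (μ₀ + μ i) / (μ₀ * μ i)
        + (1 / μ₀) * ((-ρ₀ * w) / (1 + ρ₀ * w)) + η i / (μ i * (1 - η i))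
    -- the roots `η i` exist and are smaller than `1`
    (∀ i, IsLeast (AoI.rootSet (G i) (μ i)) (η i) ∧ η i < 1) ∧
    -- mean delay in the scheduler
    (∀ n, Integrable (D₀ n) P ∧
      ∫ ω, D₀ n ω ∂P = 1 / μ₀ + (1 / μ₀) * ((-ρ₀ * w) / (1 + ρ₀ * w))) ∧
    -- mean delay in each server
    (∀ i n, Integrable (Ds i n) P ∧
      ∫ ω, Ds i n ω ∂P = 1 / μ i + η i / (μ i * (1 - η i))) ∧
    -- average AoI of the two categories
    (∀ i n, Integrable (Dpath i n) P ∧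
      AoI.averageAoI P lam₀ (Dpath i) n
        = 1 / (2 * lam₀) + ∫ ω, Φ n ω / S n ω ∂P + ∫ ω, D₀ n ω ∂P + ∫ ω, Ds i n ω ∂P ∧
      AoI.averageAoI P lam₀ (Dpath i) n = Δ i) ∧
    -- overall average AoI
    (∀ n, Integrable (Dall n) P ∧
      AoI.averageAoI P lam₀ Dall n
        = a * AoI.averageAoI P lam₀ (Dpath 0) n + b * AoI.averageAoI P lam₀ (Dpath 1) n ∧
      AoI.averageAoI P lam₀ Dall n = a * Δ 0 + b * Δ 1) ∧
    -- under ordered departures and ergodicity, these are the time averages of the age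
    (∀ i, AoI.DeparturesOrdered P lam₀ (Dpath i) → AoI.AreasErgodic P lam₀ (Dpath i) →
      ∀ᵐ ω ∂P, Tendsto (AoI.timeAverageAge lam₀ (fun n => Dpath i n ω)) atTop (𝓝 (Δ i))) ∧
    (AoI.DeparturesOrdered P lam₀ Dall → AoI.AreasErgodic P lam₀ Dall →
      ∀ᵐ ω ∂P, Tendsto (AoI.timeAverageAge lam₀ (fun n => Dall n ω)) atTop
        (𝓝 (a * Δ 0 + b * Δ 1))) := by
  intro ρ₀ w η D₀ Ds Dpath Dall Δ
  have hμ i : 0 < μ i := (hlam i).trans (hρ i)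
  have hload i : 1 / μ i < ∫ x, x ∂(G i) :=
    (one_div_lt_one_div_of_lt (hlam i) (hρ i)).trans_eq (hmean i).symm
  have hD₀ n : Integrable (D₀ n) P := hsched.integrable_sojourn hlam₀ hρ₀ n
  have hED₀ n := hsched.integral_sojourn hlam₀ hρ₀ n
  have hDs i n : Integrable (Ds i n) P := (hserv i).integrable_sojourn (hG i) (hμ i) (hload i) n
  have hEDs i n := (hserv i).integral_sojourn (hG i) (hμ i) (hload i) n
  have hΔ i n : 1 / (2 * lam₀) + ∫ ω, Φ n ω / S n ω ∂P + ∫ ω, D₀ n ω ∂P + ∫ ω, Ds i n ω ∂P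
      = Δ i := by
    simp only [Δ, ← one_div_add_one_div (hlam₀.trans hρ₀).ne' (hμ i).ne', hTconst n, D₀, hED₀ n,
      Ds, hEDs i n, ρ₀, w, η]
    ring
  have hpath i n : AoI.averageAoI P lam₀ (Dpath i) n = Δ i :=
    (AoI.averageAoI_systemDelay hlam₀ (hT _) (hD₀ _) (hDs i _)).trans (hΔ i _)
  have hall n : AoI.averageAoI P lam₀ Dall n
      = a * AoI.averageAoI P lam₀ (Dpath 0) n + b * AoI.averageAoI P lam₀ (Dpath 1) n :=
    AoI.averageAoI_systemDelay_category hlam₀ (hξm _) hab (ha _) (fun i => hcat i _) (hT _) (hD₀ _)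
      fun i => hDs i _
  have hnonneg (c : ℕ → Ω → Fin 2) := AoI.ae_nonneg_systemDelay hΦ hS
    (AoI.IsSteadyGM1.ae_nonneg_sojourn hsched (hlam₀.trans hρ₀))
    ((ae_all_iff.2 fun i => (hserv i).ae_nonneg_sojourn (hμ i)).mono fun ω h n => h (c n ω) n)
  refine ⟨fun i => ⟨AoI.isLeast_smallestRoot (hG i) (hμ i) (hload i),
      AoI.smallestRoot_lt_one (hG i) (hμ i) (hload i)⟩,
    fun n => ⟨hD₀ n, hED₀ n⟩, fun i n => ⟨hDs i n, hEDs i n⟩,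
    fun i n => ⟨AoI.integrable_systemDelay (hT n) (hD₀ n) (hDs i n),
      (hpath i n).trans (hΔ i n).symm, hpath i n⟩,
    fun n => ⟨AoI.integrable_systemDelay (hT n) (hD₀ n) (AoI.integrable_select
      ((AoI.measurable_category ξhat).comp (hξm n)) fun i => hDs i n), hall n, ?_⟩,
    fun i hord herg => ?_, fun hord herg => ?_⟩
  · rw [hall n, hpath, hpath]
  · exact hpath i 0 ▸ AoI.ae_tendsto_timeAverageAge hlam₀ (hnonneg fun _ _ => i) hord herg
  · rw [← hpath 0 0, ← hpath 1 0, ← hall 0]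
    exact AoI.ae_tendsto_timeAverageAge hlam₀ (hnonneg _) hord herg
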